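/- Let $X$ be an irreducible normal algebraic variety over an algebraically closed field $\mathbb K$ whose divisor class group $\operatorname{Cl}(X)=\operatorname{WDiv}(X)/\{\operatorname{div}(f): f\in\mathbb K(X)^\times\}$ is free and finitely generated. Let $K\subset\operatorname{WDiv}(X)$ be a subgroup of the group of Weil divisors that is mapped isomorphically onto $\operatorname{Cl}(X)$ by the projection, and let $$R(X)=\bigoplus_{D\in K}\mathcal O(X,D),\qquad \mathcal O(X,D)=\{f\in\mathbb K(X)^\times : \operatorname{div}(f)+D\ge 0\}\cup\{0\},$$ be the Cox ring of $X$, the $K$-graded $\mathbb K$-algebra in which the product of $f\in\mathcal O(X,D)$ and $g\in\mathcal O(X,E)$ is $fg\in\mathcal O(X,D+E)$. A non-zero non-invertible homogeneous element $a$ of a graded ring is called h-irreducible if $a=bc$ with $b,c$ homogeneous implies that $b$ or $c$ is invertible; the graded ring is called factorially graded if every non-zero non-invertible homogeneous element is a product of h-irreducible elements, uniquely up to association and renumbering. Then: 1. $R(X)$ is factorially graded. 2. Sending a non-zero homogeneous element $f\in\mathcal O(X,D)$, $D\in K$, to $\operatorname{div}(f)+D$ induces a well-defined bijection from the set of association classes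 of non-zero homogeneous elements of $R(X)$ onto the set of effective Weil divisors on $X$, and this bijection turns products into sums. 3. A non-zero homogeneous element $f\in\mathcal O(X,D)$, $D\in K$, is h-irreducible if and only if $\operatorname{div}(f)+D$ is a prime divisor; so the bijection in 2 identifies the classes of h-irreducible elements with the prime divisors. -/

import Mathlib

open CategoryTheory AlgebraicGeometry DirectSum

universe u

/-! ### Graded factoriality -/

section GradedFactoriality

variable {A S R : Type*} [CommRing R] [SetLike S R]

/-- A non-zero, non-invertible homogeneous element `a` is h-irreducible if in every factorization
`a = b * c` with `b` and `c` homogeneous one of the factors is invertible. -/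
def IsHIrreducible (𝒜 : A → S) (a : R) : Prop :=
  SetLike.IsHomogeneousElem 𝒜 a ∧ a ≠ 0 ∧ ¬ IsUnit a ∧
    ∀ b c : R, SetLike.IsHomogeneousElem 𝒜 b → SetLike.IsHomogeneousElem 𝒜 c → a = b * c →
      IsUnit b ∨ IsUnit c

/-- A graded ring is factorially graded if every non-zero non-invertible homogeneous element is a
product of h-irreducible elements, uniquely up to association and renumbering. -/
def IsFactoriallyGraded (𝒜 : A → S) : Prop :=
  ∀ a : R, SetLike.IsHomogeneousElem 𝒜 a → a ≠ 0 → ¬ IsUnit a →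
    (∃ s : Multiset R, (∀ p ∈ s, IsHIrreducible 𝒜 p) ∧ s.prod = a) ∧
    ∀ s t : Multiset R, (∀ p ∈ s, IsHIrreducible 𝒜 p) → (∀ p ∈ t, IsHIrreducible 𝒜 p) →
      s.prod = a → t.prod = a → Multiset.Rel Associated s t

end GradedFactoriality

/-! ### Normal varieties and Weil divisors -/

/-- An irreducible normal algebraic variety over a field `K`: an integral separated scheme of
finite type over `K` all of whose local rings are integrally closed. -/
structure NormalVariety (K : Type u) [Field K] where
  scheme : Scheme.{u}
  toBase : scheme ⟶ Spec (.of K)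
  [isIntegral : IsIntegral scheme]
  [isSeparated : IsSeparated toBase]
  [locallyOfFiniteType : LocallyOfFiniteType toBase]
  [quasiCompact : QuasiCompact toBase]
  normal : ∀ x : scheme, IsIntegrallyClosed (scheme.presheaf.stalk x)

namespace NormalVariety

noncomputable section

attribute [instance] isIntegral isSeparated locallyOfFiniteType quasiCompact

variable {K : Type u} [Field K] (X : NormalVariety K)

instance : IsLocallyNoetherian X.scheme :=
  LocallyOfFiniteType.isLocallyNoetherian X.toBase

instance : CompactSpace X.scheme :=
  (quasiCompact_iff_compactSpace X.toBase).mp X.quasiCompact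

instance : IsNoetherian X.scheme where

/-- The field of rational functions `K(X)`. -/
abbrev RatFunc : Type u := X.scheme.functionField

/-- The structure homomorphism `K → 𝒪(X)`. -/
def baseToGlobal : K →+* Γ(X.scheme, ⊤) :=
  X.toBase.appTop.hom.comp (Scheme.ΓSpecIso (.of K)).inv.hom

instance : Nonempty (⊤ : X.scheme.Opens) := ⟨⟨genericPoint X.scheme, trivial⟩⟩

instance : Algebra K X.RatFunc :=
  ((X.scheme.germToFunctionField ⊤).hom.comp X.baseToGlobal).toAlgebra

/-- The prime divisors of `X`, i.e. its irreducible closed subsets of codimension one, each given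
by its generic point (Mathlib's convention for algebraic cycles). -/
def PrimeDivisor : Type u := {x : X.scheme // Order.coheight x = 1}

/-- Weil divisors: the free abelian group on the prime divisors, with its coefficientwise order;
`D` is effective when `0 ≤ D`. -/
abbrev WDiv : Type u := X.PrimeDivisor →₀ ℤ

lemma finite_ord_ne_zero (f : X.RatFunc) :
    {P : X.PrimeDivisor | X.scheme.ord f P.1 ≠ 0}.Finite := by
  by_cases hf : f = 0
  · simp [hf]
  obtain ⟨U, -, f', hU, rfl, hunit⟩ := exists_isUnit_germ_eq X.scheme f hf
  obtain ⟨S, hS, hclosed, hirr, hcover⟩ :=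
    TopologicalSpace.NoetherianSpace.exists_finite_set_isClosed_irreducible U.isOpen.isClosed_compl
  have hη : genericPoint X.scheme ∈ U :=
    ((genericPoint_spec X.scheme).mem_open_set_iff U.isOpen).mpr (by simpa using hU)
  refine Set.Finite.of_finite_image (f := fun P : X.PrimeDivisor => closure {P.1})
    (hS.subset ?_) ?_
  · rintro _ ⟨P, hP, rfl⟩
    have hPU : P.1 ∈ (U : Set X.scheme)ᶜ := fun h => hP (Scheme.ord_of_isUnit hunit h)
    rw [hcover] at hPU
    obtain ⟨t, ht, hPt⟩ := hPU
    obtain ⟨y, hy⟩ := QuasiSober.sober (hirr t ht) (hclosed t ht)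
    have hyP : P.1 ≤ y := specializes_iff_mem_closure.mpr (by rw [hy.def]; exact hPt)
    have hyU : y ∈ (U : Set X.scheme)ᶜ := by
      rw [hcover]
      exact ⟨t, ht, hy.mem⟩
    have hytop : y < (⊤ : X.scheme) :=
      lt_iff_le_not_ge.mpr ⟨le_top, fun h => hyU (Specializes.mem_open h U.isOpen hη)⟩
    have hPy : P.1 = y := by
      by_contra hne
      have h1 := Order.coheight_add_one_le
        (lt_iff_le_not_ge.mpr ⟨hyP, fun h => hne (Specializes.antisymm h hyP).eq⟩)
      have h2 := Order.coheight_add_one_le hytop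
      rw [P.2] at h1
      rw [Order.coheight_top, zero_add] at h2
      have h3 := (add_le_add_left h2 1).trans h1
      norm_num at h3
    simp only [hPy, hy.def, ht]
  · intro P _ Q _ h
    exact Subtype.ext ((Inseparable.eq (inseparable_iff_closure_eq.mpr h)))

/-- The divisor of a rational function `f ≠ 0`. (It is `0` for `f = 0`, which is never used.) -/
def div (f : X.RatFunc) : X.WDiv :=
  Finsupp.ofSupportFinite (fun P => X.scheme.ord f P.1) (X.finite_ord_ne_zero f)

@[simp]
lemma div_apply (f : X.RatFunc) (P : X.PrimeDivisor) : X.div f P = X.scheme.ord f P.1 := rfl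

lemma div_mul {f g : X.RatFunc} (hf : f ≠ 0) (hg : g ≠ 0) :
    X.div (f * g) = X.div f + X.div g := by
  ext P
  simp [Scheme.ord_mul hf hg]

lemma div_one : X.div 1 = 0 := by
  have h := X.div_mul (one_ne_zero (α := X.RatFunc)) one_ne_zero
  rw [mul_one] at h
  exact left_eq_add.mp h

/-- The subgroup of principal divisors. -/
def principal : AddSubgroup X.WDiv where
  carrier := {D | ∃ f : X.RatFunc, f ≠ 0 ∧ X.div f = D}
  zero_mem' := ⟨1, one_ne_zero, X.div_one⟩
  add_mem' := by
    rintro _ _ ⟨f, hf, rfl⟩ ⟨g, hg, rfl⟩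
    exact ⟨f * g, mul_ne_zero hf hg, X.div_mul hf hg⟩
  neg_mem' := by
    rintro _ ⟨f, hf, rfl⟩
    refine ⟨f⁻¹, inv_ne_zero hf, eq_neg_of_add_eq_zero_left ?_⟩
    rw [← X.div_mul (inv_ne_zero hf) hf, inv_mul_cancel₀ hf, X.div_one]

/-- The divisor class group. -/
abbrev Cl : Type u := X.WDiv ⧸ X.principal

lemma isDVR (P : X.PrimeDivisor) :
    IsDiscreteValuationRing (X.scheme.presheaf.stalk P.1) := by
  have h1 : ringKrullDim (X.scheme.presheaf.stalk P.1) = 1 := by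
    rw [ringKrullDim_stalk_eq_coheight, P.2]; rfl
  have h2 := X.normal P.1
  have h3 : Ring.KrullDimLE 1 (X.scheme.presheaf.stalk P.1) := krullDimLE_of_coheight_le P.2.le
  have h4 : ¬ IsField (X.scheme.presheaf.stalk P.1) := fun h => by
    rw [ringKrullDim_eq_zero_of_isField h] at h1
    exact zero_ne_one h1
  have h5 : Ring.DimensionLEOne (X.scheme.presheaf.stalk P.1) :=
    ⟨fun {p} => Ring.krullDimLE_one_iff_of_isPrime_bot.mp h3 p⟩
  have h6 : IsDedekindDomain (X.scheme.presheaf.stalk P.1) :=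
    { toIsDomain := inferInstance
      toIsDedekindRing :=
        { toIsNoetherian := inferInstance
          toDimensionLEOne := h5
          toIsIntegralClosure := h2 } }
  exact ((IsDiscreteValuationRing.TFAE _ h4).out 0 2).mpr h6

/-- The space `𝒪(X, D) = {f ∈ K(X) | div f + D ≥ 0}`, where by convention `0 ∈ 𝒪(X, D)`. -/
def sections (D : X.WDiv) : Submodule K X.RatFunc where
  carrier := {f | f ≠ 0 → 0 ≤ X.div f + D}
  zero_mem' h := absurd rfl h
  add_mem' := by
    intro f g hf hg hfg P
    by_cases h0 : f = 0
    · subst h0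
      simp only [zero_add] at hfg ⊢
      exact hg hfg P
    by_cases h1 : g = 0
    · subst h1
      simp only [add_zero] at hfg ⊢
      exact hf hfg P
    have := X.isDVR P
    have h2 := Scheme.ord_add (x := P.1) hfg
    have h3 := hf h0 P
    have h4 := hg h1 P
    simp only [Finsupp.coe_add, Pi.add_apply, div_apply, Finsupp.coe_zero, Pi.zero_apply]
      at h3 h4 ⊢
    rcases min_le_iff.mp h2 with h | h <;> omega
  smul_mem' := by
    intro c f hf hcf P
    have hf0 : f ≠ 0 := by rintro rfl; simp at hcf
    have hc : c ≠ 0 := by rintro rfl; simp at hcf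
    have h1 : c • f = X.baseToGlobal c • f := by
      simp only [Algebra.smul_def]
      rfl
    have h2 := Scheme.ord_le_smul (x := P.1) (U := ⊤) trivial
      ((map_ne_zero_iff _ X.baseToGlobal.injective).mpr hc) f
    have h3 := hf hf0 P
    rw [h1]
    simp only [Finsupp.coe_add, Pi.add_apply, div_apply, Finsupp.coe_zero, Pi.zero_apply]
      at h3 ⊢
    omega

/-! ### The Cox ring -/

variable (L : AddSubgroup X.WDiv)

instance : SetLike.GradedMonoid fun D : L => X.sections D where
  one_mem := by
    intro _
    simp [X.div_one]
  mul_mem := by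
    intro D E f g hf hg hfg
    have hf0 := left_ne_zero_of_mul hfg
    have hg0 := right_ne_zero_of_mul hfg
    rw [X.div_mul hf0 hg0]
    calc (0 : X.WDiv) ≤ (X.div f + D) + (X.div g + E) := add_nonneg (hf hf0) (hg hg0)
      _ = X.div f + X.div g + ((D + E : L) : X.WDiv) := by
        rw [AddSubgroup.coe_add]; abel

/-- The ring `⨁ D ∈ L, 𝒪(X, D)`, whose multiplication on graded components is that of `K(X)`. It
is the Cox ring of `X` when `L` maps isomorphically onto the class group. -/
def CoxRing : Type u := ⨁ D : L, X.sections D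

open scoped Classical in
instance : CommRing (X.CoxRing L) :=
  inferInstanceAs (CommRing (⨁ D : L, X.sections D))

open scoped Classical in
instance : Algebra K (X.CoxRing L) :=
  inferInstanceAs (Algebra K (⨁ D : L, X.sections D))

open scoped Classical in
/-- The inclusion of the component `𝒪(X, D)` into the Cox ring. -/
def toCox (D : L) : X.sections D →ₗ[K] X.CoxRing L :=
  DirectSum.lof K L (fun D : L => X.sections D) D

/-- The grading of the Cox ring by `L`. -/
def coxGrading (D : L) : Submodule K (X.CoxRing L) := LinearMap.range (X.toCox L D)

lemma toCox_injective (D : L) : Function.Injective (X.toCox L D) := by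
  classical
  exact DirectSum.of_injective (β := fun D : L => X.sections D) D

lemma toCox_mul {D E : L} (f : X.sections D) (g : X.sections E) :
    X.toCox L D f * X.toCox L E g =
      X.toCox L (D + E) ⟨f * g, SetLike.mul_mem_graded (A := fun D : L => X.sections D) f.2 g.2⟩ := by
  classical
  exact DirectSum.of_mul_of (A := fun D : L => X.sections D) f g

lemma toCox_one :
    X.toCox L 0 ⟨1, SetLike.one_mem_graded (fun D : L => X.sections D)⟩ = 1 := rfl

lemma toCox_ne_zero {D : L} {f : X.sections D} (hf : f ≠ 0) : X.toCox L D f ≠ 0 :=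
  (map_ne_zero_iff _ (X.toCox_injective L D)).mpr hf

instance : SetLike.GradedMonoid (X.coxGrading L) where
  one_mem := ⟨_, X.toCox_one L⟩
  mul_mem := by
    rintro D E _ _ ⟨f, rfl⟩ ⟨g, rfl⟩
    exact ⟨_, (X.toCox_mul L f g).symm⟩

open scoped Classical in
instance : DirectSum.Decomposition (X.coxGrading L) :=
  DirectSum.Decomposition.ofLinearMap (X.coxGrading L)
    (DirectSum.lmap (fun D : L => (X.toCox L D).rangeRestrict))
    (by
      refine DirectSum.linearMap_ext K fun D => LinearMap.ext fun f => ?_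
      change DirectSum.coeLinearMap (X.coxGrading L) (DirectSum.lmap
        (fun D : L => (X.toCox L D).rangeRestrict) (DirectSum.lof K L _ D f)) = X.toCox L D f
      rw [DirectSum.lmap_lof]
      exact DirectSum.coeLinearMap_lof (X.coxGrading L) D ((X.toCox L D).rangeRestrict f))
    (by
      refine DirectSum.linearMap_ext K fun D => LinearMap.ext ?_
      rintro ⟨_, f, rfl⟩
      change DirectSum.lmap (fun D : L => (X.toCox L D).rangeRestrict)
        (DirectSum.coeLinearMap (X.coxGrading L) (DirectSum.lof K L _ D _)) = _
      rw [DirectSum.coeLinearMap_lof]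
      exact DirectSum.lmap_lof (fun D : L => (X.toCox L D).rangeRestrict) D f)

open scoped Classical in
instance : GradedAlgebra (X.coxGrading L) where

/-- The monoid of association classes of non-zero homogeneous elements of the Cox ring. -/
def homogeneousClasses : Submonoid (Associates (X.CoxRing L)) where
  carrier := {c | ∃ a : X.CoxRing L, SetLike.IsHomogeneousElem (X.coxGrading L) a ∧ a ≠ 0 ∧
    Associates.mk a = c}
  one_mem' := ⟨1, ⟨0, _, X.toCox_one L⟩, by
    rw [← X.toCox_one L]
    exact X.toCox_ne_zero L (fun h => one_ne_zero (congrArg Subtype.val h)), rfl⟩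
  mul_mem' := by
    rintro _ _ ⟨_, ⟨D, f, rfl⟩, hf, rfl⟩ ⟨_, ⟨E, g, rfl⟩, hg, rfl⟩
    refine ⟨_, ⟨D + E, _, (X.toCox_mul L f g).symm⟩, ?_, rfl⟩
    rw [X.toCox_mul L f g]
    refine X.toCox_ne_zero L fun h => ?_
    rcases mul_eq_zero.mp (congrArg Subtype.val h) with h | h
    · exact hf (by rw [show f = 0 from Subtype.ext h, map_zero])
    · exact hg (by rw [show g = 0 from Subtype.ext h, map_zero])

/-- The association class of the homogeneous element given by a non-zero `f ∈ 𝒪(X, D)`. -/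
def classOf (D : L) (f : X.sections D) (hf : f ≠ 0) : X.homogeneousClasses L :=
  ⟨Associates.mk (X.toCox L D f), X.toCox L D f, ⟨D, f, rfl⟩,
    X.toCox_ne_zero L hf, rfl⟩

end

end NormalVariety

/-! Everything is read off from the effective divisor `div f + D` of a non-zero homogeneous element,
recorded as the relation `HasDivisor`. Products have the sum of the divisors, and the order of
divisors is divisibility: if the divisor of `g` is at most that of `f`, then `f / g` is a section in
the difference of the degrees (`HasDivisor.exists_eq_mul`), and `HasDivisor.le_of_dvd` is the
converse. Hence units are the elements with divisor `0`, and associated means having the same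
divisor. Since `L` meets every divisor class, each effective divisor occurs
(`exists_hasDivisor_of_nonneg`). Up to association, the non-zero homogeneous elements thus form the
monoid of effective divisors. That monoid is free commutative on the prime divisors, so these are
its atoms, and unique factorization is inherited from it. -/

namespace NormalVariety

variable {K : Type u} [Field K] {X : NormalVariety K} {L : AddSubgroup X.WDiv}

/-! ### Divisors of homogeneous elements and divisibility -/

/-- `a` is a non-zero homogeneous element of the Cox ring, given by some `f ∈ 𝒪(X, D)` with
`div f + D = E`. -/
def HasDivisor (L : AddSubgroup X.WDiv) (a : X.CoxRing L) (E : X.WDiv) : Prop :=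
  ∃ (D : L) (f : X.sections D), f ≠ 0 ∧ X.toCox L D f = a ∧ X.div (f : X.RatFunc) + D = E

lemma hasDivisor_toCox {D : L} {f : X.sections D} (hf : f ≠ 0) :
    HasDivisor L (X.toCox L D f) (X.div (f : X.RatFunc) + D) :=
  ⟨D, f, hf, rfl, rfl⟩

lemma exists_hasDivisor {a : X.CoxRing L} (ha : SetLike.IsHomogeneousElem (X.coxGrading L) a)
    (h0 : a ≠ 0) : ∃ E, HasDivisor L a E := by
  obtain ⟨D, f, rfl⟩ := ha
  exact ⟨_, hasDivisor_toCox (by rintro rfl; exact h0 (map_zero _))⟩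

lemma hasDivisor_one : HasDivisor L 1 0 := by
  refine ⟨0, _, fun h => one_ne_zero (congrArg Subtype.val h), X.toCox_one L, ?_⟩
  simp [X.div_one]

/-- Elements of the Cox ring given by the same function in the same degree agree. -/
lemma toCox_congr {D D' : L} (h : D = D') {f : X.sections D} {f' : X.sections D'}
    (hf : (f : X.RatFunc) = f') : X.toCox L D f = X.toCox L D' f' := by
  subst h
  rw [Subtype.ext hf]

namespace HasDivisor

variable {a b : X.CoxRing L} {E F : X.WDiv}

lemma isHomogeneousElem (h : HasDivisor L a E) :
    SetLike.IsHomogeneousElem (X.coxGrading L) a := by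
  obtain ⟨D, f, -, rfl, -⟩ := h
  exact ⟨D, f, rfl⟩

lemma ne_zero (h : HasDivisor L a E) : a ≠ 0 := by
  obtain ⟨D, f, hf, rfl, -⟩ := h
  exact X.toCox_ne_zero L hf

lemma nonneg (h : HasDivisor L a E) : 0 ≤ E := by
  obtain ⟨D, f, hf, rfl, rfl⟩ := h
  exact f.2 fun h0 => hf (Subtype.ext h0)

lemma mul (ha : HasDivisor L a E) (hb : HasDivisor L b F) : HasDivisor L (a * b) (E + F) := by
  obtain ⟨D, f, hf, rfl, rfl⟩ := ha
  obtain ⟨D', g, hg, rfl, rfl⟩ := hb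
  have hf0 : (f : X.RatFunc) ≠ 0 := fun h0 => hf (Subtype.ext h0)
  have hg0 : (g : X.RatFunc) ≠ 0 := fun h0 => hg (Subtype.ext h0)
  refine ⟨D + D', _, fun h => mul_ne_zero hf0 hg0 (congrArg Subtype.val h),
    (X.toCox_mul L f g).symm, ?_⟩
  rw [X.div_mul hf0 hg0, AddSubgroup.coe_add]
  abel

/-- Homogeneous elements can be divided as soon as their divisors can. -/
lemma exists_eq_mul (ha : HasDivisor L a (E + F)) (hb : HasDivisor L b E) (hF : 0 ≤ F) :
    ∃ c, HasDivisor L c F ∧ a = b * c := by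
  obtain ⟨D, f, hf, rfl, h⟩ := ha
  obtain ⟨D', g, hg, rfl, rfl⟩ := hb
  have hf0 : (f : X.RatFunc) ≠ 0 := fun h0 => hf (Subtype.ext h0)
  have hg0 : (g : X.RatFunc) ≠ 0 := fun h0 => hg (Subtype.ext h0)
  have hq0 : (f : X.RatFunc) / g ≠ 0 := div_ne_zero hf0 hg0
  have hdiv : X.div ((f : X.RatFunc) / g) + (D - D' : L) = F := by
    have hmul := X.div_mul hq0 hg0
    rw [div_mul_cancel₀ _ hg0] at hmul
    rw [hmul] at h
    rw [AddSubgroup.coe_sub]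
    refine add_left_cancel (a := X.div (g : X.RatFunc) + D') ?_
    rw [← h]
    abel
  refine ⟨X.toCox L (D - D') ⟨f / g, fun _ => hdiv.symm ▸ hF⟩,
    ⟨_, _, fun h0 => hq0 (congrArg Subtype.val h0), rfl, hdiv⟩, ?_⟩
  rw [X.toCox_mul]
  exact toCox_congr (add_sub_cancel D' D).symm (mul_div_cancel₀ _ hg0).symm

/-- The cofactor need not be homogeneous, but as `a` and `b` are, it can be replaced by its
component in degree `deg b - deg a`; then divisors add. This makes units and association of the
whole ring visible on divisors. -/
lemma le_of_dvd (ha : HasDivisor L a E) (hb : HasDivisor L b F) (hab : a ∣ b) : E ≤ F := by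
  classical
  obtain ⟨c, rfl⟩ := hab
  have hb0 := hb.ne_zero
  have key : ∃ c', SetLike.IsHomogeneousElem (X.coxGrading L) c' ∧ a * c = a * c' := by
    obtain ⟨D, f, -, rfl, -⟩ := ha
    obtain ⟨D', g, -, hg, -⟩ := hb
    refine ⟨DirectSum.decompose (X.coxGrading L) c (D' - D), ⟨D' - D, SetLike.coe_mem _⟩, ?_⟩
    have hf : X.toCox L D f ∈ X.coxGrading L D := ⟨f, rfl⟩
    have hg' : X.toCox L D' g ∈ X.coxGrading L D' := ⟨g, rfl⟩
    rw [← DirectSum.coe_decompose_mul_add_of_left_mem (X.coxGrading L) hf, add_sub_cancel, ← hg]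
    exact (DirectSum.decompose_of_mem_same (X.coxGrading L) hg').symm
  obtain ⟨c', hc', hcc⟩ := key
  rw [hcc] at hb hb0
  obtain ⟨G, hG⟩ := exists_hasDivisor hc' (right_ne_zero_of_mul hb0)
  obtain ⟨D, f, hf, hfa, hfE⟩ := ha.mul hG
  obtain ⟨D', g, hg, hgb, hgF⟩ := hb
  -- A non-zero element has only one degree, and `toCox` is injective there, so the two descriptions
  -- of the product have the same divisor.
  have hD : D = D' := by
    refine DirectSum.degree_eq_of_mem_mem (X.coxGrading L) ⟨f, hfa⟩ ⟨g, hgb⟩ hb0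
  subst hD
  rw [X.toCox_injective L D (hfa.trans hgb.symm), hgF] at hfE
  rw [hfE]
  exact le_add_of_nonneg_right hG.nonneg

lemma eq_of_associated (ha : HasDivisor L a E) (hb : HasDivisor L b F) (h : Associated a b) :
    E = F :=
  le_antisymm (ha.le_of_dvd hb h.dvd) (hb.le_of_dvd ha h.dvd')

lemma unique (ha : HasDivisor L a E) (hb : HasDivisor L a F) : E = F :=
  ha.eq_of_associated hb (Associated.refl a)

lemma isUnit_iff (ha : HasDivisor L a E) : IsUnit a ↔ E = 0 := by
  constructor
  · exact fun h => le_antisymm (ha.le_of_dvd hasDivisor_one h.dvd) ha.nonneg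
  · rintro rfl
    -- Dividing `1` by `a` gives the inverse.
    have h1 : HasDivisor L (1 : X.CoxRing L) (0 + 0) := by simpa using hasDivisor_one
    obtain ⟨c, -, hc⟩ := h1.exists_eq_mul ha le_rfl
    exact IsUnit.of_mul_eq_one c hc.symm

lemma associated (ha : HasDivisor L a E) (hb : HasDivisor L b E) : Associated a b := by
  obtain ⟨c, hc, rfl⟩ := HasDivisor.exists_eq_mul (F := 0) (by simpa using hb) ha le_rfl
  exact associated_mul_unit_right a c (hc.isUnit_iff.mpr rfl)

end HasDivisor

/-- Every effective divisor comes from a homogeneous element, since `L` represents all classes. -/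
lemma exists_hasDivisor_of_nonneg
    (hL : Function.Surjective ((QuotientAddGroup.mk' X.principal).comp L.subtype))
    {E : X.WDiv} (hE : 0 ≤ E) : ∃ a, HasDivisor L a E := by
  obtain ⟨D, hD⟩ := hL (QuotientAddGroup.mk' X.principal E)
  -- Equality of classes yields `f` with `div f = -D + E`.
  obtain ⟨f, hf, hfE⟩ := QuotientAddGroup.eq.mp hD
  have h : X.div f + D = E := by
    rw [hfE]
    simp
  exact ⟨_, D, ⟨f, fun _ => h.symm ▸ hE⟩, fun h0 => hf (congrArg Subtype.val h0), rfl, h⟩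

/-! ### Effective divisors as multisets of prime divisors -/

/-- The effective divisor `∑ P`, the sum running over a multiset of prime divisors. -/
noncomputable def divisorOfMultiset (m : Multiset X.PrimeDivisor) : X.WDiv :=
  (m.map fun P => Finsupp.single P 1).sum

lemma divisorOfMultiset_cons (P : X.PrimeDivisor) (m : Multiset X.PrimeDivisor) :
    divisorOfMultiset (P ::ₘ m) = Finsupp.single P 1 + divisorOfMultiset m := by
  simp [divisorOfMultiset]

open scoped Classical in
lemma divisorOfMultiset_apply (m : Multiset X.PrimeDivisor) (P : X.PrimeDivisor) :
    divisorOfMultiset m P = m.count P := by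
  induction m using Multiset.induction_on with
  | empty => simp [divisorOfMultiset]
  | cons Q m ih =>
    rw [divisorOfMultiset_cons, Finsupp.add_apply, ih, Multiset.count_cons, Finsupp.single_apply]
    by_cases h : Q = P
    · subst h
      simp [add_comm]
    · simp [h, Ne.symm h]

lemma divisorOfMultiset_injective :
    Function.Injective (divisorOfMultiset : Multiset X.PrimeDivisor → X.WDiv) := by
  classical
  intro m m' h
  ext P
  have := DFunLike.congr_fun h P
  rw [divisorOfMultiset_apply, divisorOfMultiset_apply] at this
  exact_mod_cast this

lemma divisorOfMultiset_nonneg (m : Multiset X.PrimeDivisor) : 0 ≤ divisorOfMultiset m := by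
  classical
  intro P
  rw [divisorOfMultiset_apply]
  exact Int.natCast_nonneg _

lemma exists_divisorOfMultiset_eq {E : X.WDiv} (hE : 0 ≤ E) :
    ∃ m : Multiset X.PrimeDivisor, divisorOfMultiset m = E := by
  classical
  -- The truncation in `Int.toNat` loses nothing, because `E` is effective.
  refine ⟨Finsupp.toMultiset (E.mapRange Int.toNat rfl), Finsupp.ext fun P => ?_⟩
  rw [divisorOfMultiset_apply, Finsupp.count_toMultiset, Finsupp.mapRange_apply]
  exact Int.toNat_of_nonneg (hE P)

lemma single_nonneg (P : X.PrimeDivisor) : (0 : X.WDiv) ≤ Finsupp.single P 1 :=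
  Finsupp.single_nonneg.mpr zero_le_one

lemma eq_zero_or_eq_zero_of_add_eq_single {E F : X.WDiv} (hE : 0 ≤ E) (hF : 0 ≤ F)
    {P : X.PrimeDivisor} (h : E + F = Finsupp.single P 1) : E = 0 ∨ F = 0 := by
  classical
  have hval : ∀ Q, E Q + F Q = if P = Q then 1 else 0 := fun Q => by
    rw [← Finsupp.add_apply, h, Finsupp.single_apply]
  have hP := hval P
  rw [if_pos rfl] at hP
  have hEP : 0 ≤ E P := hE P
  have hFP : 0 ≤ F P := hF P
  have hor : E P = 0 ∨ F P = 0 := by omega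
  have hne : ∀ Q, P ≠ Q → E Q = 0 ∧ F Q = 0 := fun Q hPQ => by
    have h1 := hval Q
    rw [if_neg hPQ] at h1
    have h2 : 0 ≤ E Q := hE Q
    have h3 : 0 ≤ F Q := hF Q
    omega
  refine hor.imp (fun h0 => Finsupp.ext fun Q => ?_) (fun h0 => Finsupp.ext fun Q => ?_)
  · by_cases hPQ : P = Q
    · exact hPQ ▸ h0
    · exact (hne Q hPQ).1
  · by_cases hPQ : P = Q
    · exact hPQ ▸ h0
    · exact (hne Q hPQ).2

/-! ### h-irreducible elements and prime divisors -/

lemma HasDivisor.isHIrreducible_of_single {a : X.CoxRing L} {P : X.PrimeDivisor}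
    (ha : HasDivisor L a (Finsupp.single P 1)) : IsHIrreducible (X.coxGrading L) a := by
  refine ⟨ha.isHomogeneousElem, ha.ne_zero, fun hu => ?_, ?_⟩
  · exact one_ne_zero (Finsupp.single_eq_zero.mp (ha.isUnit_iff.mp hu))
  · rintro b c hb hc rfl
    obtain ⟨B, hB⟩ := exists_hasDivisor hb (left_ne_zero_of_mul ha.ne_zero)
    obtain ⟨C, hC⟩ := exists_hasDivisor hc (right_ne_zero_of_mul ha.ne_zero)
    rw [hB.isUnit_iff, hC.isUnit_iff]
    exact eq_zero_or_eq_zero_of_add_eq_single hB.nonneg hC.nonneg ((hB.mul hC).unique ha)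

/-- A homogeneous element that is not a unit splits off a factor with a prime divisor. -/
lemma HasDivisor.exists_cons {a : X.CoxRing L} {E : X.WDiv} (ha : HasDivisor L a E)
    (hu : ¬ IsUnit a) : ∃ (P : X.PrimeDivisor) (m : Multiset X.PrimeDivisor),
      E = divisorOfMultiset m + Finsupp.single P 1 := by
  obtain ⟨m, rfl⟩ := exists_divisorOfMultiset_eq ha.nonneg
  obtain ⟨P, hP⟩ := Multiset.exists_mem_of_ne_zero (s := m) fun h0 =>
    hu (ha.isUnit_iff.mpr (by simp [h0, divisorOfMultiset]))
  obtain ⟨m', rfl⟩ := Multiset.exists_cons_of_mem hP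
  exact ⟨P, m', by rw [divisorOfMultiset_cons, add_comm]⟩

lemma HasDivisor.isHIrreducible_iff
    (hL : Function.Surjective ((QuotientAddGroup.mk' X.principal).comp L.subtype))
    {a : X.CoxRing L} {E : X.WDiv} (ha : HasDivisor L a E) :
    IsHIrreducible (X.coxGrading L) a ↔ ∃ P : X.PrimeDivisor, E = Finsupp.single P 1 := by
  constructor
  · rintro ⟨-, -, hu, hirr⟩
    obtain ⟨P, m, rfl⟩ := ha.exists_cons hu
    -- Realizing the remaining divisor by `b` gives `a = b * c` with `c` of divisor `P`. As `c` is
    -- no unit, `b` is one.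
    obtain ⟨b, hb⟩ := exists_hasDivisor_of_nonneg hL (divisorOfMultiset_nonneg m)
    obtain ⟨c, hc, rfl⟩ := ha.exists_eq_mul hb (single_nonneg P)
    refine ⟨P, ?_⟩
    rcases hirr b c hb.isHomogeneousElem hc.isHomogeneousElem rfl with h | h
    · rw [hb.isUnit_iff.mp h, zero_add]
    · exact absurd (Finsupp.single_eq_zero.mp (hc.isUnit_iff.mp h)) one_ne_zero
  · rintro ⟨P, rfl⟩
    exact ha.isHIrreducible_of_single

/-! ### Unique factorization -/

lemma exists_multiset_rel
    (hL : Function.Surjective ((QuotientAddGroup.mk' X.principal).comp L.subtype))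
    (s : Multiset (X.CoxRing L)) (hs : ∀ p ∈ s, IsHIrreducible (X.coxGrading L) p) :
    ∃ m : Multiset X.PrimeDivisor,
      Multiset.Rel (fun p P => HasDivisor L p (Finsupp.single P 1)) s m := by
  induction s using Multiset.induction_on with
  | empty => exact ⟨0, Multiset.Rel.zero⟩
  | cons p s ih =>
    obtain ⟨m, hm⟩ := ih fun q hq => hs q (Multiset.mem_cons_of_mem hq)
    have hp := hs p (Multiset.mem_cons_self p s)
    obtain ⟨E, hE⟩ := exists_hasDivisor hp.1 hp.2.1
    obtain ⟨P, rfl⟩ := (hE.isHIrreducible_iff hL).mp hp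
    exact ⟨P ::ₘ m, hm.cons hE⟩

lemma hasDivisor_prod {s : Multiset (X.CoxRing L)} {m : Multiset X.PrimeDivisor}
    (h : Multiset.Rel (fun p P => HasDivisor L p (Finsupp.single P 1)) s m) :
    HasDivisor L s.prod (divisorOfMultiset m) := by
  induction h with
  | zero => simpa [divisorOfMultiset] using hasDivisor_one
  | cons hp _ ih =>
    rw [Multiset.prod_cons, divisorOfMultiset_cons]
    exact hp.mul ih

lemma rel_associated {s t : Multiset (X.CoxRing L)} {m : Multiset X.PrimeDivisor}
    (hs : Multiset.Rel (fun p P => HasDivisor L p (Finsupp.single P 1)) s m)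
    (ht : Multiset.Rel (fun p P => HasDivisor L p (Finsupp.single P 1)) t m) :
    Multiset.Rel Associated s t := by
  induction hs generalizing t with
  | zero => rw [Multiset.rel_zero_right.mp ht]; exact Multiset.Rel.zero
  | cons hp _ ih =>
    obtain ⟨q, t', hq, ht', rfl⟩ := Multiset.rel_cons_right.mp ht
    exact (ih ht').cons (hp.associated hq)

lemma exists_rel_multiset
    (hL : Function.Surjective ((QuotientAddGroup.mk' X.principal).comp L.subtype))
    (m : Multiset X.PrimeDivisor) : ∃ s : Multiset (X.CoxRing L),
      Multiset.Rel (fun p P => HasDivisor L p (Finsupp.single P 1)) s m := by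
  choose p hp using fun P : X.PrimeDivisor => exists_hasDivisor_of_nonneg hL (single_nonneg P)
  refine ⟨m.map p, Multiset.rel_map_left.mpr ?_⟩
  exact Multiset.rel_refl_of_refl_on fun P _ => hp P

theorem isFactoriallyGraded_coxGrading
    (hL : Function.Surjective ((QuotientAddGroup.mk' X.principal).comp L.subtype)) :
    IsFactoriallyGraded (X.coxGrading L) := by
  intro a ha h0 hu
  obtain ⟨E, hE⟩ := exists_hasDivisor ha h0
  refine ⟨?_, ?_⟩
  -- One prime `P` is held back: the quotient of `a` by the product for `m` has divisor `P` and
  -- absorbs the unit, so the factorization is exact.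
  · obtain ⟨P, m, rfl⟩ := hE.exists_cons hu
    obtain ⟨s, hs⟩ := exists_rel_multiset hL m
    obtain ⟨c, hc, rfl⟩ := hE.exists_eq_mul (hasDivisor_prod hs) (single_nonneg P)
    refine ⟨c ::ₘ s, fun p hp => ?_, by rw [Multiset.prod_cons, mul_comm]⟩
    rcases Multiset.mem_cons.mp hp with rfl | hp
    · exact hc.isHIrreducible_of_single
    · obtain ⟨Q, -, hQ⟩ := Multiset.exists_mem_of_rel_of_mem hs hp
      exact hQ.isHIrreducible_of_single
  · rintro s t hs ht rfl hts
    obtain ⟨m, hm⟩ := exists_multiset_rel hL s hs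
    obtain ⟨m', hm'⟩ := exists_multiset_rel hL t ht
    have h := hasDivisor_prod hm'
    rw [hts] at h
    obtain rfl := divisorOfMultiset_injective ((hasDivisor_prod hm).unique h)
    exact rel_associated hm hm'

/-! ### Association classes and effective divisors -/

lemma exists_hasDivisor_of_mem_homogeneousClasses (c : X.homogeneousClasses L) :
    ∃ (a : X.CoxRing L) (E : AddSubmonoid.nonneg X.WDiv),
      Associates.mk a = c ∧ HasDivisor L a E := by
  obtain ⟨_, a, ha, h0, rfl⟩ := c
  obtain ⟨E, hE⟩ := exists_hasDivisor ha h0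
  exact ⟨a, ⟨E, hE.nonneg⟩, rfl, hE⟩

/-- The association classes of non-zero homogeneous elements form a monoid isomorphic to that of
effective divisors. -/
theorem exists_homogeneousClasses_mulEquiv
    (hL : Function.Surjective ((QuotientAddGroup.mk' X.principal).comp L.subtype)) :
    ∃ e : X.homogeneousClasses L ≃* Multiplicative (AddSubmonoid.nonneg X.WDiv),
      ∀ (D : L) (f : X.sections D) (hf : f ≠ 0),
        ((e (X.classOf L D f hf)).toAdd : X.WDiv) = X.div (f : X.RatFunc) + (D : X.WDiv) := by
  choose r E hr hE using exists_hasDivisor_of_mem_homogeneousClasses (X := X) (L := L)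
  -- The chosen divisor `E c` does not depend on the representative.
  have key : ∀ (c : X.homogeneousClasses L) (a : X.CoxRing L) (F : X.WDiv),
      Associates.mk a = c → HasDivisor L a F → (E c : X.WDiv) = F := fun c a F hc hF =>
    (hE c).eq_of_associated hF (Associates.mk_eq_mk_iff_associated.mp ((hr c).trans hc.symm))
  let φ : X.homogeneousClasses L →ₙ* Multiplicative (AddSubmonoid.nonneg X.WDiv) :=
    { toFun := fun c => Multiplicative.ofAdd (E c)
      map_mul' := fun c d => Subtype.ext <| key (c * d) (r c * r d) (E c + E d)
        (by rw [← Associates.mk_mul_mk, hr, hr]; rfl) ((hE c).mul (hE d)) }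
  have hφ : Function.Bijective φ := by
    constructor
    · intro c d h
      have h1 : (E c : X.WDiv) = E d := congrArg Subtype.val h
      refine Subtype.ext ?_
      rw [← hr c, ← hr d]
      exact Associates.mk_eq_mk_iff_associated.mpr ((hE c).associated (h1 ▸ hE d))
    · intro F
      obtain ⟨a, ha⟩ := exists_hasDivisor_of_nonneg hL F.toAdd.2
      exact ⟨⟨Associates.mk a, a, ha.isHomogeneousElem, ha.ne_zero, rfl⟩,
        Subtype.ext (key _ a _ rfl ha)⟩
  exact ⟨MulEquiv.ofBijective φ hφ, fun D f hf => key _ _ _ rfl (hasDivisor_toCox hf)⟩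

end NormalVariety

theorem mainTheorem3 {K : Type u} [Field K] [IsAlgClosed K] (X : NormalVariety K)
    [Module.Free ℤ X.Cl] [Module.Finite ℤ X.Cl]
    (L : AddSubgroup X.WDiv)
    (hL : Function.Bijective ((QuotientAddGroup.mk' X.principal).comp L.subtype)) :
    IsFactoriallyGraded (X.coxGrading L) ∧
    (∃ e : X.homogeneousClasses L ≃* Multiplicative (AddSubmonoid.nonneg X.WDiv),
      ∀ (D : L) (f : X.sections D) (hf : f ≠ 0),
        ((e (X.classOf L D f hf)).toAdd : X.WDiv) = X.div (f : X.RatFunc) + (D : X.WDiv)) ∧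
    ∀ (D : L) (f : X.sections D), f ≠ 0 →
      (IsHIrreducible (X.coxGrading L) (X.toCox L D f) ↔
        ∃ P : X.PrimeDivisor, X.div (f : X.RatFunc) + (D : X.WDiv) = Finsupp.single P 1) :=
  ⟨NormalVariety.isFactoriallyGraded_coxGrading hL.2,
    NormalVariety.exists_homogeneousClasses_mulEquiv hL.2,
    fun _ _ hf => (NormalVariety.hasDivisor_toCox hf).isHIrreducible_iff hL.2⟩
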